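/- Let $M,\kappa_0,R,L,c_1,c_2$ be real constants with $\kappa_0,c_1>0$, and let $m:(0,\infty)\to(0,\infty)$. There exist constants $\kappa,C,\varepsilon>0$, depending only on $M,\kappa_0,R,L,c_1,c_2$ and the function $m$ (in particular not on $n,d,r,t$), such that the following holds. Let $n\ge 2$ and $d\ge 1$ be integers with $\sqrt{d\log n/n}\le\varepsilon$, let $b:\mathbb R\to\mathbb R$ be twice differentiable, let $\beta^*\in\mathbb R^d$, let $x_1,\dots,x_n$ be independent random vectors in $\mathbb R^d$, let $z_1,\dots,z_n$ be real responses (of arbitrary joint law with the $x_i$), and suppose that 1. $b''(x_i^T\beta^*)\le M$ almost surely for every $i$, and for every $\omega>0$ one has $b''(\eta)\ge m(\omega)$ for all $|\eta|\le\omega$; 2. for every $i$, $\mathbb E x_i=0$, $\lambda_{\min}(\mathbb E x_ix_i^T)\ge\kappa_0$, and $\mathbb E(v^Tx_i)^4\le R$ for all $v\in\mathbb R^d$ with $\|v\|_2=1$; 3. $\|\beta^*\|_2\le L$. Let the thresholds be $\tau_1$ with $c_1(n/\log n)^{1/4}\le\tau_1\le c_2(n/\log n)^{1/4}$ and $\tau_2\in\mathbb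 R$ arbitrary. Define the shrunk features and clipped responses $$\widetilde x_i=\frac{\min(\|x_i\|_4,\tau_1)}{\|x_i\|_4}\,x_i\quad(\widetilde x_i=0\text{ if }x_i=0),\qquad \widetilde z_i=\min(|z_i|,\tau_2),\qquad \|x\|_4=\Bigl(\sum_{j=1}^d x_j^4\Bigr)^{1/4},$$ the negative log-likelihood $$\widetilde\ell_n(\beta)=\frac1n\sum_{i=1}^n\bigl(-\widetilde z_i\,\widetilde x_i^T\beta+b(\widetilde x_i^T\beta)\bigr),$$ and its first-order Taylor remainder $\delta\widetilde\ell_n(\beta;\beta^*)=\widetilde\ell_n(\beta)-\widetilde\ell_n(\beta^*)-\nabla\widetilde\ell_n(\beta^*)^T(\beta-\beta^*)$. Then for all $0<r<1$ and $t>0$, with probability at least $1-2e^{-t}$, it holds simultaneously for all $\Delta\in\mathbb R^d$ with $\|\Delta\|_2\le r$ that $$\delta\widetilde\ell_n(\beta^*+\Delta;\beta^*)\ \ge\ \kappa\|\Delta\|_2^2-C r^2\Bigl(\sqrt{\tfrac tn}+\sqrt{\tfrac dn}\Bigr).$$ -/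

import Mathlib

open MeasureTheory ProbabilityTheory

noncomputable section

/-- The `ℓ₄`-norm of a vector of `ℝᵈ`. -/
def l4norm {d : ℕ} (x : EuclideanSpace ℝ (Fin d)) : ℝ :=
  (∑ j, x j ^ 4) ^ ((1 : ℝ) / 4)

/-- `ℓ₄`-norm shrinkage at the threshold `τ` (the zero vector is sent to itself). -/
def shrink {d : ℕ} (τ : ℝ) (x : EuclideanSpace ℝ (Fin d)) : EuclideanSpace ℝ (Fin d) :=
  (min (l4norm x) τ / l4norm x) • x

/-- Clipping of a response at the threshold `τ`. -/
def clip (τ z : ℝ) : ℝ := min |z| τ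

/-- The negative log-likelihood (up to an affine transformation) of a generalized linear model with
canonical link and cumulant function `b`, evaluated on features `x i` and responses `z i`. -/
def negLogLik {d n : ℕ} (b : ℝ → ℝ) (x : Fin n → EuclideanSpace ℝ (Fin d)) (z : Fin n → ℝ)
    (β : EuclideanSpace ℝ (Fin d)) : ℝ :=
  (1 / (n : ℝ)) * ∑ i, (-(z i) * inner ℝ (x i) β + b (inner ℝ (x i) β))

/-- The negative log-likelihood evaluated on the shrunk features and the clipped responses. -/
def shrunkNegLogLik {d n : ℕ} (b : ℝ → ℝ) (τ₁ τ₂ : ℝ) (x : Fin n → EuclideanSpace ℝ (Fin d))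
    (z : Fin n → ℝ) : EuclideanSpace ℝ (Fin d) → ℝ :=
  negLogLik b (fun i => shrink τ₁ (x i)) (fun i => clip τ₂ (z i))

/-- The first-order Taylor remainder of `f` at the base point `β₀`, evaluated at `β`. -/
def taylorRemainder {d : ℕ} (f : EuclideanSpace ℝ (Fin d) → ℝ)
    (β β₀ : EuclideanSpace ℝ (Fin d)) : ℝ :=
  f β - f β₀ - inner ℝ (gradient f β₀) (β - β₀)

/-- The matrix `E[X Xᵀ]` of a random vector `X`. -/
def secondMoment {Ω : Type*} [MeasurableSpace Ω] (μ : Measure Ω) {d : ℕ}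
    (X : Ω → EuclideanSpace ℝ (Fin d)) : Matrix (Fin d) (Fin d) ℝ :=
  Matrix.of fun j k => ∫ ω, X ω j * X ω k ∂μ

/-- The smallest eigenvalue of a real symmetric matrix of positive size. -/
def lambdaMin {d : ℕ} (A : Matrix (Fin d) (Fin d) ℝ) : ℝ := sInf (spectrum ℝ A)

end

/-!
The Taylor remainder of the likelihood does not see the responses, and it is a sum of Bregman
divergences of the convex function `b`. Dropping the summands in which the linear predictors are large,
it dominates `m (3 K) / 2 * ‖Δ‖²` times the average of the localized squares `localSq`
in the direction `v = Δ / ‖Δ‖` (`mul_sum_localSq_le_taylorRemainder`). The truncation level scales with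
`‖Δ‖` itself, so that it remains to bound this average below, uniformly over the unit sphere, by a
positive constant up to an error of order `t / n + d / n`. This error is at most `√(t / n) + √(d / n)`
when that quantity is below `1`; otherwise the claim holds because the remainder is nonnegative.

For a fixed direction, fourth moments show that truncation and shrinkage preserve a constant part of
`𝔼 ⟪x, θ⟫²` (`le_integral_localSq_shrink`), and `exp (-y) ≤ 1 - y + y² / 2` bounds the Laplace
transform of the independent sum (`integral_exp_neg_sum_le`).

Uniformity comes from a change of measure in place of symmetrization and contraction: the Laplace
transform is integrated over an annulus of directions and compared with its average over the ball of
radius `δ` around `v` (`forall_setAverage_ge_of_laplace`), at the cost `d log (2 / δ)` in the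
exponent. Averaging `⟪x, θ - v⟫²` over that ball gives at most `δ² ‖x‖² / d`, which is small uniformly
in `d` for feature vectors with `‖x‖² ≤ K d` (`setAverage_localSq_le`), while most feature vectors
satisfy this bound.
-/

/-! ### Taylor remainders -/

/-- A lower bound `c` for `b''` on `[-W, W]` makes `b - c s² / 2` convex there, and the tangent
inequality of that convex function is the claim. -/
theorem half_mul_sq_le_taylor_remainder {b : ℝ → ℝ} (hb : Differentiable ℝ b)
    (hb' : Differentiable ℝ (deriv b)) {W c : ℝ}
    (hc : ∀ η, |η| ≤ W → c ≤ deriv (deriv b) η) {y u : ℝ} (hy : |y| ≤ W) (hyu : |y + u| ≤ W) :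
    c / 2 * u ^ 2 ≤ b (y + u) - b y - deriv b y * u := by
  set g : ℝ → ℝ := fun s => b s - c / 2 * s ^ 2 with hg
  have hg1 : ∀ s, HasDerivAt g (deriv b s - c * s) s := fun s => by
    have h := (hb s).hasDerivAt.sub (((hasDerivAt_id s).pow 2).const_mul (c / 2))
    exact h.congr_deriv (by simp only [id]; push_cast; ring)
  have hdg : deriv g = fun s => deriv b s - c * s := funext fun s => (hg1 s).deriv
  have hg2 : ∀ s, HasDerivAt (deriv g) (deriv (deriv b) s - c) s := fun s => by
    rw [hdg]
    have h := (hb' s).hasDerivAt.sub ((hasDerivAt_id s).const_mul c)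
    exact h.congr_deriv (by ring)
  have hconv : ConvexOn ℝ (Set.Icc (-W) W) g := by
    refine convexOn_of_deriv2_nonneg (convex_Icc _ _)
      (fun s _ => (hg1 s).continuousAt.continuousWithinAt)
      (fun s _ => (hg1 s).differentiableAt.differentiableWithinAt)
      (fun s _ => (hg2 s).differentiableAt.differentiableWithinAt) fun s hs => ?_
    have hs' := interior_subset hs
    have : deriv^[2] g s = deriv (deriv b) s - c := (hg2 s).deriv
    rw [this]
    linarith [hc s (abs_le.2 hs')]
  have key : (deriv b y - c * y) * u ≤ g (y + u) - g y := by
    rcases lt_trichotomy u 0 with hu | hu | hu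
    · have h := hconv.slope_le_of_hasDerivAt (abs_le.1 hyu) (abs_le.1 hy) (by linarith) (hg1 y)
      rw [slope_def_field, div_le_iff₀ (by linarith)] at h
      linarith
    · simp [hu]
    · have h := hconv.le_slope_of_hasDerivAt (abs_le.1 hy) (abs_le.1 hyu) (by linarith) (hg1 y)
      rw [slope_def_field, le_div_iff₀ (by linarith)] at h
      linarith
  simp only [hg] at key
  linarith

/-- The responses enter the likelihood linearly, so they drop out of the Taylor remainder. -/
theorem taylorRemainder_negLogLik {d n : ℕ} {b : ℝ → ℝ} (hb : Differentiable ℝ b)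
    (x : Fin n → EuclideanSpace ℝ (Fin d)) (z : Fin n → ℝ) (β Δ : EuclideanSpace ℝ (Fin d)) :
    taylorRemainder (negLogLik b x z) (β + Δ) β =
      (1 / (n : ℝ)) * ∑ i, (b (inner ℝ (x i) β + inner ℝ (x i) Δ) - b (inner ℝ (x i) β) -
        deriv b (inner ℝ (x i) β) * inner ℝ (x i) Δ) := by
  have hin : ∀ i, HasFDerivAt (fun β : EuclideanSpace ℝ (Fin d) => inner ℝ (x i) β)
      (innerSL ℝ (x i)) β := fun i => (innerSL ℝ (x i)).hasFDerivAt
  have hF : HasFDerivAt (negLogLik b x z)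
      ((1 / (n : ℝ)) • ∑ i, (-(z i) • innerSL ℝ (x i) +
        deriv b (inner ℝ (x i) β) • innerSL ℝ (x i))) β := by
    refine HasFDerivAt.const_mul (HasFDerivAt.fun_sum fun i _ => ?_) _
    exact ((hin i).const_mul _).add ((hb _).hasDerivAt.comp_hasFDerivAt β (hin i))
  rw [taylorRemainder, inner_gradient_left, hF.fderiv]
  simp only [negLogLik, add_sub_cancel_left, smul_apply,
    sum_apply, add_apply, innerSL_apply_apply, smul_eq_mul,
    inner_add_right]
  rw [← mul_sub, ← mul_sub, ← Finset.sum_sub_distrib, ← Finset.sum_sub_distrib]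
  congr 1
  refine Finset.sum_congr rfl fun i _ => ?_
  ring

/-! ### The smallest eigenvalue -/

/-- The Rayleigh quotient of a symmetric matrix is at least its smallest eigenvalue. -/
theorem lambdaMin_mul_le_dotProduct_mulVec {d : ℕ} {A : Matrix (Fin d) (Fin d) ℝ}
    (hA : A.IsHermitian) {c : ℝ} (hc : c ≤ lambdaMin A) (v : Fin d → ℝ) :
    c * (v ⬝ᵥ v) ≤ v ⬝ᵥ A.mulVec v := by
  have hbdd : BddBelow (spectrum ℝ A) := by
    rw [hA.spectrum_real_eq_range_eigenvalues]
    exact (Set.finite_range _).bddBelow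
  have hB : (A - c • (1 : Matrix (Fin d) (Fin d) ℝ)).IsHermitian :=
    hA.sub (by simp [Matrix.IsHermitian])
  have hpsd : (A - c • (1 : Matrix (Fin d) (Fin d) ℝ)).PosSemidef := by
    rw [hB.posSemidef_iff_eigenvalues_nonneg]
    intro j
    have hj : hB.eigenvalues j ∈ spectrum ℝ (A - c • (1 : Matrix (Fin d) (Fin d) ℝ)) := by
      rw [hB.spectrum_real_eq_range_eigenvalues]
      exact ⟨j, rfl⟩
    have hj' : hB.eigenvalues j + c ∈ spectrum ℝ A := by
      rw [spectrum.add_mem_iff, Algebra.algebraMap_eq_smul_one, neg_add_eq_sub]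
      exact hj
    have := csInf_le hbdd hj'
    simp only [lambdaMin] at hc
    simp only [Pi.zero_apply]
    linarith
  have h := hpsd.dotProduct_mulVec_nonneg v
  simp only [star_trivial, Matrix.sub_mulVec, Matrix.smul_mulVec, Matrix.one_mulVec,
    dotProduct_sub, dotProduct_smul, smul_eq_mul] at h
  linarith

/-! ### Averaging over a small ball -/

/-- Isotropy of the centred ball: a reflection exchanges two vectors of equal norm and preserves
the ball and its volume. -/
theorem setIntegral_inner_sq_eq_of_norm_eq {E : Type*} [NormedAddCommGroup E]
    [InnerProductSpace ℝ E] [FiniteDimensional ℝ E] [MeasurableSpace E] [BorelSpace E]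
    {u v : E} (h : ‖u‖ = ‖v‖) (δ : ℝ) :
    ∫ s in Metric.ball (0 : E) δ, inner ℝ u s ^ 2 =
      ∫ s in Metric.ball (0 : E) δ, inner ℝ v s ^ 2 := by
  set T := (ℝ ∙ (u - v))ᗮ.reflection
  have hT : T u = v := Submodule.reflection_sub h
  have hpre : T ⁻¹' Metric.ball 0 δ = Metric.ball 0 δ := by
    ext s
    simp
  have := T.measurePreserving.setIntegral_preimage_emb
    T.toHomeomorph.measurableEmbedding (fun s => inner ℝ v s ^ 2) (Metric.ball 0 δ)
  rw [hpre] at this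
  rw [← this]
  congr 1
  ext s
  rw [← hT, T.inner_map_map]

/-- By isotropy each direction carries the fraction `1 / d` of `∫ ‖s‖²`. This factor `1 / d`
compensates the size `‖x‖² ∼ d` of a feature vector. -/
theorem setIntegral_ball_inner_sq_le {d : ℕ} (hd : 0 < d) (x : EuclideanSpace ℝ (Fin d)) (δ : ℝ) :
    ∫ s in Metric.ball (0 : EuclideanSpace ℝ (Fin d)) δ, inner ℝ x s ^ 2 ≤
      (volume (Metric.ball (0 : EuclideanSpace ℝ (Fin d)) δ)).toReal * (δ ^ 2 * ‖x‖ ^ 2 / d) := by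
  set B := Metric.ball (0 : EuclideanSpace ℝ (Fin d)) δ
  set e := EuclideanSpace.basisFun (Fin d) ℝ
  have hint : ∀ u : EuclideanSpace ℝ (Fin d), IntegrableOn (fun s => inner ℝ u s ^ 2) B := fun u =>
    (((by fun_prop : Continuous fun s => inner ℝ u s ^ 2).continuousOn).integrableOn_compact
      (isCompact_closedBall 0 δ)).mono_set Metric.ball_subset_closedBall
  have hj : ∀ j, ∫ s in B, inner ℝ x s ^ 2 = ‖x‖ ^ 2 * ∫ s in B, inner ℝ (e j) s ^ 2 := fun j => by
    rw [setIntegral_inner_sq_eq_of_norm_eq (u := x) (v := ‖x‖ • e j) (by simp [norm_smul]),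
      ← integral_const_mul]
    simp [B, inner_smul_left, mul_pow]
  have hsum : ∑ j, ∫ s in B, inner ℝ (e j) s ^ 2 ≤ (volume B).toReal * δ ^ 2 := by
    rw [← integral_finsetSum _ fun j _ => hint (e j)]
    have h2 : ∀ s, ∑ j, inner ℝ (e j) s ^ 2 = ‖s‖ ^ 2 := fun s => e.sum_sq_inner_right s
    simp only [h2]
    calc ∫ s in B, ‖s‖ ^ 2 ≤ ∫ s in B, δ ^ 2 := by
          refine setIntegral_mono_on ?_ ?_ measurableSet_ball fun s hs => ?_
          · exact (((by fun_prop : Continuous fun s : EuclideanSpace ℝ (Fin d) =>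
              ‖s‖ ^ 2).continuousOn).integrableOn_compact
              (isCompact_closedBall 0 δ)).mono_set Metric.ball_subset_closedBall
          · exact integrableOn_const (measure_ball_lt_top.ne)
          · have : ‖s‖ < δ := by simpa [B] using hs
            gcongr
      _ = (volume B).toReal * δ ^ 2 := by simp [Measure.real]
  have htot : (d : ℝ) * ∫ s in B, inner ℝ x s ^ 2 ≤ ‖x‖ ^ 2 * ((volume B).toReal * δ ^ 2) := by
    calc (d : ℝ) * ∫ s in B, inner ℝ x s ^ 2 = ∑ _j : Fin d, ∫ s in B, inner ℝ x s ^ 2 := by simp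
      _ = ∑ j, ‖x‖ ^ 2 * ∫ s in B, inner ℝ (e j) s ^ 2 := Finset.sum_congr rfl fun j _ => hj j
      _ ≤ _ := by
        rw [← Finset.mul_sum]
        gcongr
  have hd' : (0 : ℝ) < d := by exact_mod_cast hd
  rw [← mul_div_assoc, le_div_iff₀ hd']
  linarith

theorem setAverage_ball_inner_sub_sq_le {d : ℕ} (hd : 0 < d) (x v : EuclideanSpace ℝ (Fin d))
    {δ : ℝ} (hδ : 0 < δ) :
    ⨍ θ in Metric.ball v δ, inner ℝ x (θ - v) ^ 2 ≤ δ ^ 2 * ‖x‖ ^ 2 / d := by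
  have hB : ∀ w : EuclideanSpace ℝ (Fin d), volume (Metric.ball w δ) =
      volume (Metric.ball (0 : EuclideanSpace ℝ (Fin d)) δ) := fun w =>
    Measure.addHaar_ball_center _ _ _
  have hpos : 0 < (volume (Metric.ball (0 : EuclideanSpace ℝ (Fin d)) δ)).toReal :=
    ENNReal.toReal_pos (Metric.measure_ball_pos _ _ hδ).ne' measure_ball_lt_top.ne
  have hsh : ∫ θ in Metric.ball v δ, inner ℝ x (θ - v) ^ 2 =
      ∫ s in Metric.ball (0 : EuclideanSpace ℝ (Fin d)) δ, inner ℝ x s ^ 2 := by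
    have h := (measurePreserving_sub_right volume v).setIntegral_preimage_emb
      (measurableEmbedding_subRight v) (fun s => inner ℝ x s ^ 2) (Metric.ball 0 δ)
    rw [← h]
    congr 2
    ext s
    simp [dist_eq_norm]
  rw [setAverage_eq, hsh, Measure.real, hB, smul_eq_mul, inv_mul_le_iff₀ hpos]
  exact setIntegral_ball_inner_sq_le hd x δ

/-- A pointwise bound on the Laplace transform of a nonnegative random field `F` yields, with
probability `1 - e^{-t}`, a lower bound on its averages over all balls of radius `δ` centred on the
unit sphere simultaneously. By Fubini and Markov, `∫ exp (-F ω θ) dθ` over the annulus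
`1 / 2 ≤ ‖θ‖ < 2` is at most `e^{t - c}` times the volume of the ball of radius `2`; each small ball
lies in the annulus and occupies the fraction `(δ / 2)^d` of that volume, and Jensen's inequality
moves the average into the exponent. The supremum thus costs only `d log (2 / δ)`. -/
theorem forall_setAverage_ge_of_laplace {d : ℕ} (hd : 0 < d) {Ω : Type*} [MeasurableSpace Ω]
    {μ : Measure Ω} [IsProbabilityMeasure μ] {F : Ω → EuclideanSpace ℝ (Fin d) → ℝ}
    (hF : Measurable (Function.uncurry F)) (hF0 : ∀ ω θ, 0 ≤ F ω θ)
    {N : ℝ} (hFN : ∀ ω θ, F ω θ ≤ N) {c : ℝ}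
    (hlap : ∀ θ : EuclideanSpace ℝ (Fin d), 1 / 2 ≤ ‖θ‖ → ‖θ‖ ≤ 2 →
      ∫ ω, Real.exp (-F ω θ) ∂μ ≤ Real.exp (-c))
    {δ : ℝ} (hδ : 0 < δ) (hδ2 : δ ≤ 1 / 2) (t : ℝ) :
    1 - Real.exp (-t) ≤ μ.real {ω | ∀ v : EuclideanSpace ℝ (Fin d), ‖v‖ = 1 →
      c - t - d * Real.log (2 / δ) ≤ ⨍ θ in Metric.ball v δ, F ω θ} := by
  have : Nonempty (Fin d) := ⟨⟨0, hd⟩⟩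
  set S : Set (EuclideanSpace ℝ (Fin d)) := {θ | 1 / 2 ≤ ‖θ‖ ∧ ‖θ‖ < 2}
  set V₁ := (volume (Metric.ball (0 : EuclideanSpace ℝ (Fin d)) 1))
  have hV₁ : V₁ ≠ 0 := (Metric.measure_ball_pos _ _ one_pos).ne'
  have hV₁' : V₁ ≠ ⊤ := measure_ball_lt_top.ne
  have hball : ∀ (w : EuclideanSpace ℝ (Fin d)) {ρ : ℝ}, 0 ≤ ρ →
      volume (Metric.ball w ρ) = ENNReal.ofReal (ρ ^ d) * V₁ := fun w ρ hρ => by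
    simpa using Measure.addHaar_ball (volume : Measure (EuclideanSpace ℝ (Fin d))) w hρ
  have hSvol : volume S ≤ ENNReal.ofReal (2 ^ d) * V₁ := by
    rw [← hball 0 (by norm_num : (0:ℝ) ≤ 2)]
    exact measure_mono fun θ hθ => by simpa using hθ.2
  have hmeasF : Measurable (Function.uncurry fun ω θ => ENNReal.ofReal (Real.exp (-F ω θ))) :=
    (Real.measurable_exp.comp hF.neg).ennreal_ofReal
  have hFω : ∀ ω, Measurable (F ω) := fun ω => hF.comp measurable_prodMk_left
  have hFθ : ∀ θ, Measurable (fun ω => F ω θ) := fun θ => hF.comp measurable_prodMk_right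
  set I : Ω → ENNReal := fun ω => ∫⁻ θ in S, ENNReal.ofReal (Real.exp (-F ω θ))
  have hImeas : Measurable I := hmeasF.lintegral_prod_right
  have hI : ∫⁻ ω, I ω ∂μ ≤ ENNReal.ofReal (Real.exp (-c)) * (ENNReal.ofReal (2 ^ d) * V₁) := by
    rw [lintegral_lintegral_swap hmeasF.aemeasurable]
    calc ∫⁻ θ in S, ∫⁻ ω, ENNReal.ofReal (Real.exp (-F ω θ)) ∂μ
        ≤ ∫⁻ _θ in S, ENNReal.ofReal (Real.exp (-c)) := by
          refine setLIntegral_mono measurable_const fun θ hθ => ?_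
          rw [← ofReal_integral_eq_lintegral_ofReal]
          · exact ENNReal.ofReal_le_ofReal (hlap θ hθ.1 hθ.2.le)
          · refine Integrable.of_bound
              (Real.measurable_exp.comp (hFθ θ).neg).aestronglyMeasurable 1
              (Filter.Eventually.of_forall fun ω => ?_)
            simpa [abs_of_pos (Real.exp_pos _)] using hF0 ω θ
          · exact Filter.Eventually.of_forall fun ω => (Real.exp_pos _).le
      _ ≤ _ := by
          rw [setLIntegral_const]
          gcongr
  set A : ENNReal := ENNReal.ofReal (Real.exp (t - c)) * (ENNReal.ofReal (2 ^ d) * V₁)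
  have hA0 : A ≠ 0 := by
    simp only [A, ne_eq, mul_eq_zero, hV₁, ENNReal.ofReal_eq_zero, not_or, not_le, or_false]
    exact ⟨Real.exp_pos _, by positivity⟩
  have hA1 : A ≠ ⊤ := ENNReal.mul_ne_top ENNReal.ofReal_ne_top
    (ENNReal.mul_ne_top ENNReal.ofReal_ne_top hV₁')
  have hmarkov : μ {ω | A ≤ I ω} ≤ ENNReal.ofReal (Real.exp (-t)) := by
    refine (meas_ge_le_lintegral_div hImeas.aemeasurable hA0 hA1).trans ?_
    refine ENNReal.div_le_of_le_mul (hI.trans (le_of_eq ?_))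
    simp only [A]
    rw [← mul_assoc (ENNReal.ofReal (Real.exp (-t))), ← ENNReal.ofReal_mul (Real.exp_pos _).le,
      ← Real.exp_add]
    congr 3
    ring
  have hgood : 1 - Real.exp (-t) ≤ μ.real {ω | A ≤ I ω}ᶜ := by
    rw [probReal_compl_eq_one_sub (measurableSet_le measurable_const hImeas)]
    have : μ.real {ω | A ≤ I ω} ≤ Real.exp (-t) :=
      ENNReal.toReal_le_of_le_ofReal (Real.exp_pos _).le hmarkov
    linarith
  refine hgood.trans (measureReal_mono ?_ (measure_ne_top _ _))
  intro ω hω v hv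
  have hω' : I ω < A := not_le.1 hω
  have hsub : Metric.ball v δ ⊆ S := fun θ hθ => by
    have h1 : ‖θ - v‖ < δ := by simpa [dist_eq_norm] using hθ
    have h2 := norm_sub_norm_le v θ
    have h3 := norm_sub_norm_le θ v
    rw [norm_sub_rev] at h2
    exact ⟨by linarith, by linarith⟩
  have hfin : volume (Metric.ball v δ) ≠ ⊤ := measure_ball_lt_top.ne
  have hne : volume (Metric.ball v δ) ≠ 0 := (Metric.measure_ball_pos _ _ hδ).ne'
  have : IsFiniteMeasure (volume.restrict (Metric.ball v δ)) := ⟨by simpa using hfin.lt_top⟩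
  have hintE : IntegrableOn (fun θ => Real.exp (-F ω θ)) (Metric.ball v δ) := by
    refine Integrable.of_bound
      (Real.measurable_exp.comp (hFω ω).neg).aestronglyMeasurable 1
      (Filter.Eventually.of_forall fun θ => ?_)
    simpa [abs_of_pos (Real.exp_pos _)] using hF0 ω θ
  have hintF : IntegrableOn (fun θ => -F ω θ) (Metric.ball v δ) := by
    refine Integrable.of_bound (hFω ω).neg.aestronglyMeasurable N
      (Filter.Eventually.of_forall fun θ => ?_)
    rw [norm_neg, Real.norm_of_nonneg (hF0 ω θ)]
    exact hFN ω θ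
  have hJ := convexOn_exp.map_set_average_le Real.continuous_exp.continuousOn isClosed_univ hne hfin
    (Filter.Eventually.of_forall fun _ => Set.mem_univ _) hintF hintE
  have hIle : ∫ θ in Metric.ball v δ, Real.exp (-F ω θ) ≤
      Real.exp (t - c) * (2 ^ d * V₁.toReal) := by
    have h1 : ENNReal.ofReal (∫ θ in Metric.ball v δ, Real.exp (-F ω θ)) ≤ A := by
      rw [ofReal_integral_eq_lintegral_ofReal hintE
        (Filter.Eventually.of_forall fun ω => (Real.exp_pos _).le)]
      exact (lintegral_mono_set hsub).trans hω'.le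
    have h2 := (ENNReal.ofReal_le_iff_le_toReal hA1).1 h1
    simpa [A, ENNReal.toReal_mul, ENNReal.toReal_ofReal (Real.exp_pos _).le] using h2
  have hVr :
      (volume : Measure (EuclideanSpace ℝ (Fin d))).real (Metric.ball v δ) = δ ^ d * V₁.toReal := by
    rw [Measure.real, hball v hδ.le, ENNReal.toReal_mul, ENNReal.toReal_ofReal (by positivity)]
  have hV₁pos : 0 < V₁.toReal := ENNReal.toReal_pos hV₁ hV₁'
  have hexp : Real.exp (⨍ θ in Metric.ball v δ, -F ω θ) ≤
      Real.exp (t - c + d * Real.log (2 / δ)) := by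
    refine hJ.trans ?_
    rw [setAverage_eq, hVr, smul_eq_mul, inv_mul_le_iff₀ (by positivity), Real.exp_add,
      mul_comm (d : ℝ), Real.exp_mul, Real.exp_log (by positivity), Real.rpow_natCast, div_pow]
    refine hIle.trans (le_of_eq ?_)
    field_simp
  have hle := Real.exp_le_exp.1 hexp
  have hneg : ⨍ θ in Metric.ball v δ, -F ω θ = -⨍ θ in Metric.ball v δ, F ω θ := by
    rw [setAverage_eq, setAverage_eq, integral_neg, smul_neg]
  rw [hneg] at hle
  linarith

/-! ### Localized squares -/

/-- The square `⟪x, θ⟫²`, kept only when `|⟪x, θ⟫| ≤ a` and the feature vector `x` is moderate: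
`|⟪x, β⟫| ≤ K` and `‖x‖² ≤ K d`. -/
noncomputable def localSq {d : ℕ} (K a : ℝ) (β x θ : EuclideanSpace ℝ (Fin d)) : ℝ :=
  open Classical in
  if |inner ℝ x β| ≤ K ∧ ‖x‖ ^ 2 ≤ K * d ∧ |inner ℝ x θ| ≤ a then inner ℝ x θ ^ 2 else 0

theorem localSq_nonneg {d : ℕ} (K a : ℝ) (β x θ : EuclideanSpace ℝ (Fin d)) :
    0 ≤ localSq K a β x θ := by
  unfold localSq
  split_ifs <;> positivity

theorem localSq_le {d : ℕ} (K a : ℝ) (β x θ : EuclideanSpace ℝ (Fin d)) :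
    localSq K a β x θ ≤ a ^ 2 := by
  unfold localSq
  split_ifs with h
  · exact sq_le_sq' (abs_le.1 h.2.2).1 (abs_le.1 h.2.2).2
  · positivity

theorem measurable_localSq {d : ℕ} {Ω : Type*} [MeasurableSpace Ω] (K a : ℝ)
    (β : EuclideanSpace ℝ (Fin d)) {f g : Ω → EuclideanSpace ℝ (Fin d)} (hf : Measurable f)
    (hg : Measurable g) : Measurable fun ω => localSq K a β (f ω) (g ω) := by
  have hfg : Measurable fun ω => inner ℝ (f ω) (g ω) := hf.inner hg
  have hfβ : Measurable fun ω => inner ℝ (f ω) β := hf.inner measurable_const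
  unfold localSq
  refine Measurable.ite ?_ (hfg.pow_const 2) measurable_const
  refine (measurableSet_le (continuous_abs.measurable.comp hfβ) measurable_const).inter
    ((measurableSet_le (hf.norm.pow_const 2) measurable_const).inter
      (measurableSet_le (continuous_abs.measurable.comp hfg) measurable_const))

/-- Moving `θ` to `v` changes the localized square by a factor `2` and an error quadratic in
`θ - v`, provided that the truncation level is doubled. -/
theorem localSq_le_add {d : ℕ} {K : ℝ} (β x v θ : EuclideanSpace ℝ (Fin d)) :
    localSq K K β x θ ≤ 2 * localSq K (2 * K) β x v + 2 * inner ℝ x (θ - v) ^ 2 := by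
  have h0 := localSq_nonneg K (2 * K) β x v
  by_cases h : |inner ℝ x β| ≤ K ∧ ‖x‖ ^ 2 ≤ K * d ∧ |inner ℝ x θ| ≤ K
  · rw [localSq, if_pos h, inner_sub_right]
    by_cases hv : |inner ℝ x v| ≤ 2 * K
    · rw [localSq, if_pos ⟨h.1, h.2.1, hv⟩]
      nlinarith [sq_nonneg (2 * inner ℝ x v - inner ℝ x θ)]
    · -- here `|⟪x, θ⟫| ≤ K < |⟪x, v⟫| - |⟪x, θ⟫| ≤ |⟪x, θ - v⟫|`
      have h1 := abs_sub_abs_le_abs_sub (inner ℝ x v) (inner ℝ x θ)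
      rw [abs_sub_comm] at h1
      have h2 : inner ℝ x θ ^ 2 ≤ (inner ℝ x θ - inner ℝ x v) ^ 2 := by
        rw [← sq_abs, ← sq_abs (inner ℝ x θ - inner ℝ x v)]
        exact pow_le_pow_left₀ (abs_nonneg _) (by linarith [h.2.2]) 2
      nlinarith [sq_nonneg (inner ℝ x θ - inner ℝ x v)]
  · rw [localSq, if_neg h]
    positivity

/-- On the event `‖x‖² ≤ K d` the smoothing error is `δ² ‖x‖² / d ≤ δ² K`, free of the dimension. -/
theorem setAverage_localSq_le {d : ℕ} (hd : 0 < d) {K : ℝ} (hK : 0 < K)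
    (β x v : EuclideanSpace ℝ (Fin d)) {δ : ℝ} (hδ : 0 < δ) :
    ⨍ θ in Metric.ball v δ, localSq K K β x θ ≤ 2 * localSq K (2 * K) β x v + 2 * (δ ^ 2 * K) := by
  have h0 := localSq_nonneg K (2 * K) β x v
  by_cases hx : ‖x‖ ^ 2 ≤ K * d
  · have hpos : 0 < (volume : Measure (EuclideanSpace ℝ (Fin d))).real (Metric.ball v δ) :=
      ENNReal.toReal_pos (Metric.measure_ball_pos _ _ hδ).ne' measure_ball_lt_top.ne
    have hav := setAverage_ball_inner_sub_sq_le hd x v hδ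
    have hsm : δ ^ 2 * ‖x‖ ^ 2 / d ≤ δ ^ 2 * K := by
      rw [div_le_iff₀ (by exact_mod_cast hd), mul_assoc]
      gcongr
    have hi : IntegrableOn (fun θ => inner ℝ x (θ - v) ^ 2) (Metric.ball v δ) :=
      (((by fun_prop : Continuous fun θ => inner ℝ x (θ - v) ^ 2).continuousOn).integrableOn_compact
        (isCompact_closedBall v δ)).mono_set Metric.ball_subset_closedBall
    have hc : IntegrableOn (fun _ : EuclideanSpace ℝ (Fin d) => 2 * localSq K (2 * K) β x v)
      (Metric.ball v δ) := integrableOn_const measure_ball_lt_top.ne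
    have hl : IntegrableOn (fun θ => localSq K K β x θ) (Metric.ball v δ) := by
      refine Measure.integrableOn_of_bounded measure_ball_lt_top.ne
        (measurable_localSq K K β measurable_const measurable_id).aestronglyMeasurable
        (M := K ^ 2) (Filter.Eventually.of_forall fun θ => ?_)
      rw [Real.norm_of_nonneg (localSq_nonneg _ _ _ _ _)]
      exact localSq_le _ _ _ _ _
    have hi' : IntegrableOn (fun θ => 2 * inner ℝ x (θ - v) ^ 2) (Metric.ball v δ) := hi.const_mul 2
    have hs : IntegrableOn (fun θ => 2 * localSq K (2 * K) β x v + 2 * inner ℝ x (θ - v) ^ 2)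
      (Metric.ball v δ) := hc.add hi'
    rw [setAverage_eq, smul_eq_mul, inv_mul_le_iff₀ hpos] at hav ⊢
    calc ∫ θ in Metric.ball v δ, localSq K K β x θ
        ≤ ∫ θ in Metric.ball v δ, (2 * localSq K (2 * K) β x v + 2 * inner ℝ x (θ - v) ^ 2) :=
          integral_mono hl hs fun θ => localSq_le_add β x v θ
      _ = (volume : Measure (EuclideanSpace ℝ (Fin d))).real (Metric.ball v δ) *
            (2 * localSq K (2 * K) β x v) + 2 * ∫ θ in Metric.ball v δ, inner ℝ x (θ - v) ^ 2 := by
          rw [integral_add hc hi', setIntegral_const, smul_eq_mul, integral_const_mul]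
      _ ≤ _ := by nlinarith
  · have : ∀ θ, localSq K K β x θ = 0 := fun θ => if_neg fun h => hx h.2.1
    simp only [this, setAverage_eq, integral_zero, smul_zero]
    positivity

/-- Comparison of fourth powers avoids the fractional power in `l4norm`. -/
theorem shrink_eq_self {d : ℕ} {τ : ℝ} (hτ : 0 ≤ τ) {x : EuclideanSpace ℝ (Fin d)}
    (hx : ∑ j, x j ^ 4 ≤ τ ^ 4) : shrink τ x = x := by
  have hs : 0 ≤ ∑ j, x j ^ 4 := Finset.sum_nonneg fun j _ => by positivity
  have hle : l4norm x ≤ τ := by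
    calc l4norm x ≤ (τ ^ 4) ^ ((1 : ℝ) / 4) := Real.rpow_le_rpow hs hx (by norm_num)
      _ = τ := by
        rw [← Real.rpow_natCast, ← Real.rpow_mul hτ]
        norm_num
  unfold shrink
  rw [min_eq_left hle]
  by_cases h0 : l4norm x = 0
  · have h1 := (Real.rpow_eq_zero hs (by norm_num)).1 h0
    have h2 : x = 0 := by
      ext j
      have := (Finset.sum_eq_zero_iff_of_nonneg fun j _ => by positivity).1 h1 j (Finset.mem_univ j)
      simpa using this
    simp [h2]
  · rw [div_self h0, one_smul]

theorem measurable_shrink {d : ℕ} (τ : ℝ) : Measurable (shrink (d := d) τ) := by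
  have h : Measurable (l4norm (d := d)) := by
    unfold l4norm
    exact (Finset.measurable_sum _ fun j _ => by fun_prop).pow_const _
  unfold shrink
  exact ((h.min measurable_const).div h).smul measurable_id

theorem norm_pow_four_le {d : ℕ} (x : EuclideanSpace ℝ (Fin d)) :
    (‖x‖ ^ 2) ^ 2 ≤ d * ∑ j, x j ^ 4 := by
  rw [EuclideanSpace.real_norm_sq_eq]
  have h := sq_sum_le_card_mul_sum_sq (s := Finset.univ) (f := fun j => x j ^ 2)
  simpa [← pow_mul] using h

/-- Truncation and shrinkage cost little: if some truncation is active, then the bracket is at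
least `1` and the left side is at most `u² - η u⁴ - 1 / (4 η) ≤ 0` with `u = ⟪x, θ⟫`. -/
theorem sub_le_localSq_shrink {d : ℕ} (hd : 0 < d) {K τ η : ℝ} (hK : 0 < K) (hτ : 0 < τ)
    (hη : 0 < η) (β x θ : EuclideanSpace ℝ (Fin d)) :
    inner ℝ x θ ^ 2 - η * inner ℝ x θ ^ 4 - 1 / (4 * η) *
      ((∑ j, x j ^ 4) / τ ^ 4 + inner ℝ x θ ^ 4 / K ^ 4 + inner ℝ x β ^ 4 / K ^ 4 +
        (∑ j, x j ^ 4) / (K ^ 2 * d)) ≤ localSq K K β (shrink τ x) θ := by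
  have hd' : (0 : ℝ) < d := by exact_mod_cast hd
  have hs : 0 ≤ ∑ j, x j ^ 4 := Finset.sum_nonneg fun j _ => by positivity
  have hT1 : 0 ≤ (∑ j, x j ^ 4) / τ ^ 4 := by positivity
  have hT2 : 0 ≤ inner ℝ x θ ^ 4 / K ^ 4 := by positivity
  have hT3 : 0 ≤ inner ℝ x β ^ 4 / K ^ 4 := by positivity
  have hT4 : 0 ≤ (∑ j, x j ^ 4) / (K ^ 2 * d) := by positivity
  by_cases hg : ∑ j, x j ^ 4 ≤ τ ^ 4 ∧ |inner ℝ x β| ≤ K ∧ ‖x‖ ^ 2 ≤ K * d ∧ |inner ℝ x θ| ≤ K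
  · rw [shrink_eq_self hτ.le hg.1, localSq, if_pos hg.2]
    have h1 : 0 ≤ η * inner ℝ x θ ^ 4 := by positivity
    have h2 : 0 ≤ 1 / (4 * η) * ((∑ j, x j ^ 4) / τ ^ 4 + inner ℝ x θ ^ 4 / K ^ 4 +
      inner ℝ x β ^ 4 / K ^ 4 + (∑ j, x j ^ 4) / (K ^ 2 * d)) := by positivity
    linarith
  · refine le_trans ?_ (localSq_nonneg _ _ _ _ _)
    have habs : ∀ u : ℝ, ¬ |u| ≤ K → 1 ≤ u ^ 4 / K ^ 4 := fun u hu => by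
      rw [le_div_iff₀ (by positivity), one_mul, ← (by decide : Even 4).pow_abs u]
      exact pow_le_pow_left₀ hK.le (not_le.1 hu).le 4
    have hone : 1 ≤ (∑ j, x j ^ 4) / τ ^ 4 + inner ℝ x θ ^ 4 / K ^ 4 + inner ℝ x β ^ 4 / K ^ 4 +
        (∑ j, x j ^ 4) / (K ^ 2 * d) := by
      by_cases h1 : ∑ j, x j ^ 4 ≤ τ ^ 4
      · by_cases h2 : |inner ℝ x β| ≤ K
        · by_cases h3 : |inner ℝ x θ| ≤ K
          · have h4 : K * d < ‖x‖ ^ 2 := not_le.1 fun h4 => hg ⟨h1, h2, h4, h3⟩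
            have h5 : (K * d) ^ 2 ≤ (‖x‖ ^ 2) ^ 2 := pow_le_pow_left₀ (by positivity) h4.le 2
            have h6 : 1 ≤ (∑ j, x j ^ 4) / (K ^ 2 * d) := by
              rw [le_div_iff₀ (by positivity), one_mul]
              have h7 := h5.trans (norm_pow_four_le x)
              exact le_of_mul_le_mul_left (by linarith) hd'
            linarith
          · linarith [habs _ h3]
        · linarith [habs _ h2]
      · have : 1 ≤ (∑ j, x j ^ 4) / τ ^ 4 := by
          rw [le_div_iff₀ (by positivity), one_mul]
          exact (not_le.1 h1).le
        linarith
    have hamgm : inner ℝ x θ ^ 2 ≤ η * inner ℝ x θ ^ 4 + 1 / (4 * η) := by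
      have : 0 ≤ (2 * η * inner ℝ x θ ^ 2 - 1) ^ 2 / (4 * η) := by positivity
      have e : (2 * η * inner ℝ x θ ^ 2 - 1) ^ 2 / (4 * η) =
        η * inner ℝ x θ ^ 4 + 1 / (4 * η) - inner ℝ x θ ^ 2 := by
        field_simp
        ring
      linarith
    have h2 : 1 / (4 * η) * 1 ≤ 1 / (4 * η) * ((∑ j, x j ^ 4) / τ ^ 4 + inner ℝ x θ ^ 4 / K ^ 4 +
      inner ℝ x β ^ 4 / K ^ 4 + (∑ j, x j ^ 4) / (K ^ 2 * d)) := by gcongr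
    linarith

/-! ### Moments of one feature vector -/

/-- The fourth-moment assumption on the unit sphere, extended by homogeneity. -/
theorem integrable_inner_pow_four {d : ℕ} {Ω : Type*} [MeasurableSpace Ω] {μ : Measure Ω} {R : ℝ}
    {X : Ω → EuclideanSpace ℝ (Fin d)}
    (hmom : ∀ v : EuclideanSpace ℝ (Fin d), ‖v‖ = 1 →
      Integrable (fun ω => (inner ℝ v (X ω)) ^ 4) μ ∧ ∫ ω, (inner ℝ v (X ω)) ^ 4 ∂μ ≤ R)
    (θ : EuclideanSpace ℝ (Fin d)) :
    Integrable (fun ω => inner ℝ (X ω) θ ^ 4) μ ∧ ∫ ω, inner ℝ (X ω) θ ^ 4 ∂μ ≤ R * ‖θ‖ ^ 4 := by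
  by_cases h0 : θ = 0
  · simp [h0]
  · have hn : ‖θ‖ ≠ 0 := norm_ne_zero_iff.2 h0
    have hv := hmom (‖θ‖⁻¹ • θ) (by rw [norm_smul, norm_inv, norm_norm, inv_mul_cancel₀ hn])
    have he : (fun ω => inner ℝ (X ω) θ ^ 4) =
        fun ω => ‖θ‖ ^ 4 * (inner ℝ (‖θ‖⁻¹ • θ) (X ω)) ^ 4 := by
      ext ω
      rw [real_inner_smul_left, real_inner_comm]
      field_simp
    rw [he, integral_const_mul, mul_comm R]
    exact ⟨hv.1.const_mul _, by gcongr; exact hv.2⟩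

theorem mul_norm_sq_le_integral_inner_sq {d : ℕ} {Ω : Type*} [MeasurableSpace Ω] {μ : Measure Ω}
    [IsProbabilityMeasure μ] {κ₀ : ℝ} {X : Ω → EuclideanSpace ℝ (Fin d)} (hX : Measurable X)
    (h4 : ∀ j, Integrable (fun ω => X ω j ^ 4) μ) (hcov : κ₀ ≤ lambdaMin (secondMoment μ X))
    (θ : EuclideanSpace ℝ (Fin d)) :
    Integrable (fun ω => inner ℝ (X ω) θ ^ 2) μ ∧
      κ₀ * ‖θ‖ ^ 2 ≤ ∫ ω, inner ℝ (X ω) θ ^ 2 ∂μ := by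
  have hXj : ∀ j, Measurable fun ω => X ω j := fun j => by fun_prop
  have hjk : ∀ j k, Integrable (fun ω => X ω j * X ω k) μ := fun j k => by
    refine Integrable.mono' (((integrable_const (1 : ℝ)).add (h4 j)).add (h4 k))
      ((hXj j).mul (hXj k)).aestronglyMeasurable (Filter.Eventually.of_forall fun ω => ?_)
    simp only [Pi.add_apply, Real.norm_eq_abs]
    rw [abs_le]
    constructor <;> nlinarith [sq_nonneg (X ω j - X ω k), sq_nonneg (X ω j + X ω k),
      sq_nonneg (X ω j ^ 2 - 1), sq_nonneg (X ω k ^ 2 - 1), sq_nonneg (X ω j ^ 2),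
      sq_nonneg (X ω k ^ 2)]
  have he : (fun ω => inner ℝ (X ω) θ ^ 2) =
      fun ω => ∑ j, ∑ k, θ j * θ k * (X ω j * X ω k) := by
    ext ω
    rw [PiLp.inner_apply, sq, Finset.sum_mul_sum]
    refine Finset.sum_congr rfl fun j _ => Finset.sum_congr rfl fun k _ => ?_
    simp only [RCLike.inner_apply, conj_trivial]
    ring
  have hH : (secondMoment μ X).IsHermitian := by
    ext j k
    simp [secondMoment, mul_comm]
  have hray := lambdaMin_mul_le_dotProduct_mulVec hH hcov θ
  rw [he]
  refine ⟨integrable_finsetSum _ fun j _ => integrable_finsetSum _ fun k _ =>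
    (hjk j k).const_mul _, ?_⟩
  rw [integral_finsetSum _ fun j _ => integrable_finsetSum _ fun k _ => (hjk j k).const_mul _]
  have hn : ‖θ‖ ^ 2 = θ.ofLp ⬝ᵥ θ.ofLp := by
    rw [EuclideanSpace.real_norm_sq_eq, dotProduct]
    simp only [sq]
  rw [hn]
  refine hray.trans (le_of_eq ?_)
  rw [dotProduct]
  refine Finset.sum_congr rfl fun j _ => ?_
  rw [integral_finsetSum _ fun k _ => (hjk j k).const_mul _, Matrix.mulVec, dotProduct,
    Finset.mul_sum]
  refine Finset.sum_congr rfl fun k _ => ?_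
  rw [integral_const_mul]
  simp only [secondMoment, Matrix.of_apply]
  ring

/-- The localized quadratic form keeps a constant part of the second moment. Each of the four
truncations contributes at most `p / (4 η)`, by the fourth-moment bound; `η` and `p` are chosen so that
the total loss is `κ₀ / 16 + κ₀ / 16`, to be compared with `κ₀ ‖θ‖² ≥ κ₀ / 4`. -/
theorem le_integral_localSq_shrink {d : ℕ} (hd : 0 < d) {Ω : Type*} [MeasurableSpace Ω]
    {μ : Measure Ω} [IsProbabilityMeasure μ] {κ₀ R L K τ η p : ℝ} (hκ₀ : 0 < κ₀) (hR : 0 < R)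
    (hK : 0 < K) (hτ : 0 < τ) (hη : η = κ₀ / (256 * R)) (hp : p = η * κ₀ / 16)
    {X : Ω → EuclideanSpace ℝ (Fin d)} (hX : Measurable X)
    (hcov : κ₀ ≤ lambdaMin (secondMoment μ X))
    (hmom : ∀ v : EuclideanSpace ℝ (Fin d), ‖v‖ = 1 →
      Integrable (fun ω => (inner ℝ v (X ω)) ^ 4) μ ∧ ∫ ω, (inner ℝ v (X ω)) ^ 4 ∂μ ≤ R)
    {β : EuclideanSpace ℝ (Fin d)} (hβ : ‖β‖ ≤ L)
    (hp1 : d * R ≤ p * τ ^ 4) (hp2 : 16 * R ≤ p * K ^ 4) (hp3 : R * L ^ 4 ≤ p * K ^ 4)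
    (hp4 : R ≤ p * K ^ 2)
    {θ : EuclideanSpace ℝ (Fin d)} (hθ1 : 1 / 2 ≤ ‖θ‖) (hθ2 : ‖θ‖ ≤ 2) :
    κ₀ / 8 ≤ ∫ ω, localSq K K β (shrink τ (X ω)) θ ∂μ := by
  have hd' : (0 : ℝ) < d := by exact_mod_cast hd
  have hη0 : 0 < η := by rw [hη]; positivity
  have hcoord : ∀ j, Integrable (fun ω => X ω j ^ 4) μ ∧ ∫ ω, X ω j ^ 4 ∂μ ≤ R := fun j => by
    simpa [EuclideanSpace.inner_single_right] using
      integrable_inner_pow_four hmom (EuclideanSpace.basisFun (Fin d) ℝ j)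
  obtain ⟨hi2, hsec⟩ := mul_norm_sq_le_integral_inner_sq hX (fun j => (hcoord j).1) hcov θ
  obtain ⟨hiθ, hmθ⟩ := integrable_inner_pow_four hmom θ
  obtain ⟨hiβ, hmβ⟩ := integrable_inner_pow_four hmom β
  have hiS : Integrable (fun ω => ∑ j, X ω j ^ 4) μ :=
    integrable_finsetSum _ fun j _ => (hcoord j).1
  have hmS : ∫ ω, ∑ j, X ω j ^ 4 ∂μ ≤ d * R := by
    rw [integral_finsetSum _ fun j _ => (hcoord j).1]
    calc ∑ j, ∫ ω, X ω j ^ 4 ∂μ ≤ ∑ _j : Fin d, R := Finset.sum_le_sum fun j _ => (hcoord j).2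
      _ = d * R := by simp
  have hmθ' : ∫ ω, inner ℝ (X ω) θ ^ 4 ∂μ ≤ 16 * R := by
    have : ‖θ‖ ^ 4 ≤ 2 ^ 4 := pow_le_pow_left₀ (norm_nonneg _) hθ2 4
    nlinarith
  have hmβ' : ∫ ω, inner ℝ (X ω) β ^ 4 ∂μ ≤ R * L ^ 4 :=
    hmβ.trans (by gcongr)
  have hsec' : κ₀ / 4 ≤ ∫ ω, inner ℝ (X ω) θ ^ 2 ∂μ := by
    have : (1 / 2 : ℝ) ^ 2 ≤ ‖θ‖ ^ 2 := pow_le_pow_left₀ (by norm_num) hθ1 2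
    nlinarith
  have hil : Integrable (fun ω => localSq K K β (shrink τ (X ω)) θ) μ := by
    refine Integrable.of_bound (measurable_localSq K K β ((measurable_shrink τ).comp hX)
      measurable_const).aestronglyMeasurable (K ^ 2) (Filter.Eventually.of_forall fun ω => ?_)
    rw [Real.norm_of_nonneg (localSq_nonneg _ _ _ _ _)]
    exact localSq_le _ _ _ _ _
  have hs2 : Integrable (fun ω => (∑ j, X ω j ^ 4) / τ ^ 4 + inner ℝ (X ω) θ ^ 4 / K ^ 4) μ :=
    (hiS.div_const _).add (hiθ.div_const _)
  have hs3 : Integrable (fun ω => (∑ j, X ω j ^ 4) / τ ^ 4 + inner ℝ (X ω) θ ^ 4 / K ^ 4 +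
      inner ℝ (X ω) β ^ 4 / K ^ 4) μ := hs2.add (hiβ.div_const _)
  have hs4 : Integrable (fun ω => (∑ j, X ω j ^ 4) / τ ^ 4 + inner ℝ (X ω) θ ^ 4 / K ^ 4 +
      inner ℝ (X ω) β ^ 4 / K ^ 4 + (∑ j, X ω j ^ 4) / (K ^ 2 * d)) μ := hs3.add (hiS.div_const _)
  have hdiff : Integrable (fun ω => inner ℝ (X ω) θ ^ 2 - η * inner ℝ (X ω) θ ^ 4) μ :=
    hi2.sub (hiθ.const_mul η)
  have hmono := integral_mono (hdiff.sub (hs4.const_mul (1 / (4 * η)))) hil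
    fun ω => sub_le_localSq_shrink hd hK hτ hη0 β (X ω) θ
  refine le_trans ?_ hmono
  have e : ∫ ω, (inner ℝ (X ω) θ ^ 2 - η * inner ℝ (X ω) θ ^ 4 - 1 / (4 * η) *
      ((∑ j, X ω j ^ 4) / τ ^ 4 + inner ℝ (X ω) θ ^ 4 / K ^ 4 + inner ℝ (X ω) β ^ 4 / K ^ 4 +
        (∑ j, X ω j ^ 4) / (K ^ 2 * d))) ∂μ =
      ∫ ω, inner ℝ (X ω) θ ^ 2 ∂μ - η * ∫ ω, inner ℝ (X ω) θ ^ 4 ∂μ - 1 / (4 * η) *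
      ((∫ ω, ∑ j, X ω j ^ 4 ∂μ) / τ ^ 4 + (∫ ω, inner ℝ (X ω) θ ^ 4 ∂μ) / K ^ 4 +
        (∫ ω, inner ℝ (X ω) β ^ 4 ∂μ) / K ^ 4 + (∫ ω, ∑ j, X ω j ^ 4 ∂μ) / (K ^ 2 * d)) := by
    rw [integral_sub hdiff (hs4.const_mul _), integral_sub hi2 (hiθ.const_mul η),
      integral_const_mul, integral_const_mul, integral_add hs3 (hiS.div_const _),
      integral_add hs2 (hiβ.div_const _), integral_add (hiS.div_const _) (hiθ.div_const _),
      integral_div, integral_div, integral_div, integral_div]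
  refine le_trans ?_ e.symm.le
  have b1 : (∫ ω, ∑ j, X ω j ^ 4 ∂μ) / τ ^ 4 ≤ p := by
    rw [div_le_iff₀ (by positivity)]
    linarith
  have b2 : (∫ ω, inner ℝ (X ω) θ ^ 4 ∂μ) / K ^ 4 ≤ p := by
    rw [div_le_iff₀ (by positivity)]
    linarith
  have b3 : (∫ ω, inner ℝ (X ω) β ^ 4 ∂μ) / K ^ 4 ≤ p := by
    rw [div_le_iff₀ (by positivity)]
    linarith
  have b4 : (∫ ω, ∑ j, X ω j ^ 4 ∂μ) / (K ^ 2 * d) ≤ p := by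
    rw [div_le_iff₀ (by positivity)]
    nlinarith
  have b5 : 1 / (4 * η) * ((∫ ω, ∑ j, X ω j ^ 4 ∂μ) / τ ^ 4 +
      (∫ ω, inner ℝ (X ω) θ ^ 4 ∂μ) / K ^ 4 + (∫ ω, inner ℝ (X ω) β ^ 4 ∂μ) / K ^ 4 +
      (∫ ω, ∑ j, X ω j ^ 4 ∂μ) / (K ^ 2 * d)) ≤ 1 / (4 * η) * (4 * p) := by
    gcongr
    linarith
  have b6 : 1 / (4 * η) * (4 * p) = κ₀ / 16 := by
    rw [hp]
    field_simp
  have b7 : η * ∫ ω, inner ℝ (X ω) θ ^ 4 ∂μ ≤ κ₀ / 16 := by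
    calc η * ∫ ω, inner ℝ (X ω) θ ^ 4 ∂μ ≤ η * (16 * R) := by gcongr
      _ = κ₀ / 16 := by
        rw [hη]
        field_simp
        norm_num
  linarith

/-! ### Laplace transform of the localized quadratic form -/

theorem exp_neg_le_one_sub_add_sq {y : ℝ} (hy : 0 ≤ y) : Real.exp (-y) ≤ 1 - y + y ^ 2 / 2 := by
  have h := Real.quadratic_le_exp_of_nonneg hy
  rw [Real.exp_neg, inv_le_iff_one_le_mul₀ (Real.exp_pos y)]
  nlinarith [sq_nonneg (y - 1), sq_nonneg (y ^ 2)]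

/-- Lower-tail Laplace bound for sums of independent nonnegative bounded variables. -/
theorem integral_exp_neg_sum_le {n : ℕ} {Ω : Type*} [MeasurableSpace Ω] {μ : Measure Ω}
    [IsProbabilityMeasure μ] {Y : Fin n → Ω → ℝ} (hY : ∀ i, Measurable (Y i))
    (hind : iIndepFun Y μ) {B q lam : ℝ} (hlam : 0 ≤ lam) (hY0 : ∀ i ω, 0 ≤ Y i ω)
    (hYB : ∀ i ω, Y i ω ≤ B) (hq : ∀ i, q ≤ ∫ ω, Y i ω ∂μ) :
    ∫ ω, Real.exp (-(lam * ∑ i, Y i ω)) ∂μ ≤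
      Real.exp (-(n * (lam * q - lam ^ 2 * B ^ 2 / 2))) := by
  have hYi : ∀ i, Integrable (Y i) μ := fun i =>
    Integrable.of_bound (hY i).aestronglyMeasurable B (Filter.Eventually.of_forall fun ω => by
      rw [Real.norm_of_nonneg (hY0 i ω)]
      exact hYB i ω)
  have hmgf := hind.mgf_sum hY Finset.univ (t := -lam)
  have hone : ∀ i, mgf (Y i) μ (-lam) ≤ Real.exp (-(lam * q - lam ^ 2 * B ^ 2 / 2)) := fun i => by
    have hpt : ∀ ω, Real.exp (-lam * Y i ω) ≤ 1 + lam ^ 2 * B ^ 2 / 2 - lam * Y i ω := fun ω => by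
      have h1 := exp_neg_le_one_sub_add_sq (mul_nonneg hlam (hY0 i ω))
      have h2 : (lam * Y i ω) ^ 2 ≤ lam ^ 2 * B ^ 2 := by
        rw [mul_pow]
        gcongr
        · exact hY0 i ω
        · exact hYB i ω
      rw [neg_mul]
      linarith
    have hexpi : Integrable (fun ω => Real.exp (-lam * Y i ω)) μ := by
      refine Integrable.of_bound
        (Real.measurable_exp.comp ((hY i).const_mul (-lam))).aestronglyMeasurable 1
        (Filter.Eventually.of_forall fun ω => ?_)
      rw [Real.norm_of_nonneg (Real.exp_pos _).le, Real.exp_le_one_iff, neg_mul]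
      exact neg_nonpos.2 (mul_nonneg hlam (hY0 i ω))
    have h3 := integral_mono hexpi ((integrable_const (1 + lam ^ 2 * B ^ 2 / 2)).sub
      ((hYi i).const_mul lam)) hpt
    simp only [Pi.sub_apply] at h3
    rw [integral_sub (integrable_const _) ((hYi i).const_mul lam), integral_const_mul,
      integral_const, probReal_univ, one_smul] at h3
    have h4 := mul_le_mul_of_nonneg_left (hq i) hlam
    have h5 := Real.add_one_le_exp (-(lam * q - lam ^ 2 * B ^ 2 / 2))
    simp only [mgf]
    linarith
  have he : ∫ ω, Real.exp (-(lam * ∑ i, Y i ω)) ∂μ = mgf (∑ i, Y i) μ (-lam) := by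
    simp [mgf, Finset.sum_apply, neg_mul]
  rw [he, hmgf]
  calc ∏ i, mgf (Y i) μ (-lam)
      ≤ ∏ _i : Fin n, Real.exp (-(lam * q - lam ^ 2 * B ^ 2 / 2)) :=
        Finset.prod_le_prod (fun i _ => mgf_nonneg) fun i _ => hone i
    _ = _ := by
      rw [Finset.prod_const, Finset.card_univ, Fintype.card_fin, ← Real.exp_nat_mul]
      congr 1
      ring

/-! ### Restricted strong convexity -/

theorem taylor_remainder_nonneg {b m : ℝ → ℝ} (hb : Differentiable ℝ b)
    (hb' : Differentiable ℝ (deriv b)) (hm : ∀ w : ℝ, 0 < w → 0 < m w)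
    (hbm : ∀ w : ℝ, 0 < w → ∀ η : ℝ, |η| ≤ w → m w ≤ deriv (deriv b) η) (y u : ℝ) :
    0 ≤ b (y + u) - b y - deriv b y * u := by
  have hW : 0 < |y| + |u| + 1 := by positivity
  have h := half_mul_sq_le_taylor_remainder hb hb' (hbm _ hW) (y := y) (u := u)
    (by linarith [abs_nonneg u]) (by linarith [abs_add_le y u])
  have := hm _ hW
  exact le_trans (by positivity) h

theorem taylorRemainder_negLogLik_nonneg {d n : ℕ} {b m : ℝ → ℝ} (hb : Differentiable ℝ b)
    (hb' : Differentiable ℝ (deriv b)) (hm : ∀ w : ℝ, 0 < w → 0 < m w)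
    (hbm : ∀ w : ℝ, 0 < w → ∀ η : ℝ, |η| ≤ w → m w ≤ deriv (deriv b) η)
    (x : Fin n → EuclideanSpace ℝ (Fin d)) (z : Fin n → ℝ) (β Δ : EuclideanSpace ℝ (Fin d)) :
    0 ≤ taylorRemainder (negLogLik b x z) (β + Δ) β := by
  rw [taylorRemainder_negLogLik hb]
  exact mul_nonneg (by positivity)
    (Finset.sum_nonneg fun i _ => taylor_remainder_nonneg hb hb' hm hbm _ _)

/-- The likelihood remainder in the direction `v`, at distance `ρ ≤ 1`, dominates `ρ²` times the
localized quadratic form: when `|⟪x, β⟫| ≤ K` and `|⟪x, v⟫| ≤ 2 K`, the segment stays in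
`[-3 K, 3 K]`, where `b'' ≥ m (3 K)`; the other summands are nonnegative by convexity. -/
theorem mul_sum_localSq_le_taylorRemainder {d n : ℕ} {b m : ℝ → ℝ} (hb : Differentiable ℝ b)
    (hb' : Differentiable ℝ (deriv b)) (hm : ∀ w : ℝ, 0 < w → 0 < m w)
    (hbm : ∀ w : ℝ, 0 < w → ∀ η : ℝ, |η| ≤ w → m w ≤ deriv (deriv b) η)
    (x : Fin n → EuclideanSpace ℝ (Fin d)) (z : Fin n → ℝ) (β v : EuclideanSpace ℝ (Fin d))
    {K ρ : ℝ} (hK : 0 < K) (hρ0 : 0 ≤ ρ) (hρ1 : ρ ≤ 1) :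
    m (3 * K) / 2 * ρ ^ 2 * ((1 / (n : ℝ)) * ∑ i, localSq K (2 * K) β (x i) v) ≤
      taylorRemainder (negLogLik b x z) (β + ρ • v) β := by
  rw [taylorRemainder_negLogLik hb, mul_left_comm, Finset.mul_sum]
  refine mul_le_mul_of_nonneg_left (Finset.sum_le_sum fun i _ => ?_) (by positivity)
  rw [inner_smul_right]
  by_cases h : |inner ℝ (x i) β| ≤ K ∧ ‖x i‖ ^ 2 ≤ K * d ∧ |inner ℝ (x i) v| ≤ 2 * K
  · rw [localSq, if_pos h]
    have h1 : |ρ * inner ℝ (x i) v| ≤ 2 * K := by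
      rw [abs_mul, abs_of_nonneg hρ0]
      nlinarith [abs_nonneg (inner ℝ (x i) v), h.2.2]
    have := half_mul_sq_le_taylor_remainder hb hb' (hbm (3 * K) (by positivity))
      (y := inner ℝ (x i) β) (u := ρ * inner ℝ (x i) v) (by linarith [h.1])
      (by linarith [h.1, abs_add_le (inner ℝ (x i) β) (ρ * inner ℝ (x i) v)])
    rw [mul_pow, ← mul_assoc] at this
    exact this
  · rw [localSq, if_neg h, mul_zero]
    exact taylor_remainder_nonneg hb hb' hm hbm _ _

/-- The empirical localized quadratic form is bounded below uniformly over the unit sphere. -/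
theorem prob_forall_sum_localSq_ge {d n : ℕ} (hd : 0 < d) (hn : 0 < n) {Ω : Type*}
    [MeasurableSpace Ω] {μ : Measure Ω} [IsProbabilityMeasure μ]
    {x : Fin n → Ω → EuclideanSpace ℝ (Fin d)} (hx : ∀ i, Measurable (x i))
    (hind : iIndepFun x μ) {K q τ δ : ℝ} {β : EuclideanSpace ℝ (Fin d)} (hK : 0 < K) (hq : 0 < q)
    (hδ : 0 < δ) (hδ2 : δ ≤ 1 / 2) (hδK : δ ^ 2 * K ≤ q / 16)
    (hmean : ∀ i, ∀ θ : EuclideanSpace ℝ (Fin d), 1 / 2 ≤ ‖θ‖ → ‖θ‖ ≤ 2 →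
      q ≤ ∫ ω, localSq K K β (shrink τ (x i ω)) θ ∂μ) (t : ℝ) :
    1 - Real.exp (-t) ≤ μ.real {ω | ∀ v : EuclideanSpace ℝ (Fin d), ‖v‖ = 1 →
      3 * q / 16 - K ^ 4 / (2 * q) * (t / n + Real.log (2 / δ) * (d / n)) ≤
        (1 / (n : ℝ)) * ∑ i, localSq K (2 * K) β (shrink τ (x i ω)) v} := by
  have hn' : (0 : ℝ) < n := by exact_mod_cast hn
  -- `q / K ^ 4` maximizes the exponent `lam * q - lam ^ 2 * K ^ 4 / 2`
  set lam := q / K ^ 4 with hlam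
  have hlam0 : 0 < lam := by positivity
  set F : Ω → EuclideanSpace ℝ (Fin d) → ℝ := fun ω θ =>
    lam * ∑ i, localSq K K β (shrink τ (x i ω)) θ
  have hsx : ∀ i, Measurable fun ω => shrink τ (x i ω) := fun i => (measurable_shrink τ).comp (hx i)
  have hF : Measurable (Function.uncurry F) := by
    refine (Finset.measurable_sum _ fun i _ => ?_).const_mul lam
    exact measurable_localSq K K β ((hsx i).comp measurable_fst) measurable_snd
  have hF0 : ∀ ω θ, 0 ≤ F ω θ := fun ω θ =>
    mul_nonneg hlam0.le (Finset.sum_nonneg fun i _ => localSq_nonneg _ _ _ _ _)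
  have hFN : ∀ ω θ, F ω θ ≤ lam * (n * K ^ 2) := fun ω θ => by
    refine mul_le_mul_of_nonneg_left ?_ hlam0.le
    calc ∑ i, localSq K K β (shrink τ (x i ω)) θ ≤ ∑ _i : Fin n, K ^ 2 :=
          Finset.sum_le_sum fun i _ => localSq_le _ _ _ _ _
      _ = n * K ^ 2 := by simp
  have hlap : ∀ θ : EuclideanSpace ℝ (Fin d), 1 / 2 ≤ ‖θ‖ → ‖θ‖ ≤ 2 →
      ∫ ω, Real.exp (-F ω θ) ∂μ ≤ Real.exp (-(n * (q ^ 2 / (2 * K ^ 4)))) := fun θ h1 h2 => by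
    have hm1 : ∀ i, Measurable fun w => localSq K K β (shrink τ w) θ := fun i : Fin n =>
      measurable_localSq K K β (measurable_shrink τ) measurable_const
    have h := integral_exp_neg_sum_le (μ := μ)
      (Y := fun i ω => localSq K K β (shrink τ (x i ω)) θ) (B := K ^ 2) (q := q) (lam := lam)
      (fun i => (hm1 i).comp (hx i)) (hind.comp _ hm1) hlam0.le
      (fun i ω => localSq_nonneg _ _ _ _ _) (fun i ω => localSq_le _ _ _ _ _)
      (fun i => hmean i θ h1 h2)
    refine h.trans (le_of_eq ?_)
    congr 3
    rw [hlam]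
    field_simp
    ring
  refine (forall_setAverage_ge_of_laplace hd hF hF0 hFN hlap hδ hδ2 t).trans
    (measureReal_mono ?_ (measure_ne_top _ _))
  intro ω hω v hv
  have h := hω v hv
  have hav : ⨍ θ in Metric.ball v δ, F ω θ ≤
      lam * (2 * ∑ i, localSq K (2 * K) β (shrink τ (x i ω)) v + n * (q / 8)) := by
    have hl : ∀ i, IntegrableOn (fun θ => localSq K K β (shrink τ (x i ω)) θ)
        (Metric.ball v δ) := fun i => by
      refine Measure.integrableOn_of_bounded measure_ball_lt_top.ne
        (measurable_localSq K K β measurable_const measurable_id).aestronglyMeasurable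
        (M := K ^ 2) (Filter.Eventually.of_forall fun θ => ?_)
      rw [Real.norm_of_nonneg (localSq_nonneg _ _ _ _ _)]
      exact localSq_le _ _ _ _ _
    have e : ⨍ θ in Metric.ball v δ, F ω θ =
        lam * ∑ i, ⨍ θ in Metric.ball v δ, localSq K K β (shrink τ (x i ω)) θ := by
      simp only [F, setAverage_eq, smul_eq_mul]
      rw [integral_const_mul, integral_finsetSum _ fun i _ => hl i, ← Finset.mul_sum]
      ring
    rw [e]
    refine mul_le_mul_of_nonneg_left ?_ hlam0.le
    calc ∑ i, ⨍ θ in Metric.ball v δ, localSq K K β (shrink τ (x i ω)) θ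
        ≤ ∑ i, (2 * localSq K (2 * K) β (shrink τ (x i ω)) v + q / 8) :=
          Finset.sum_le_sum fun i _ =>
            (setAverage_localSq_le hd hK β _ v hδ).trans (by linarith)
      _ = _ := by simp [Finset.sum_add_distrib, Finset.mul_sum]
  set S := ∑ i, localSq K (2 * K) β (shrink τ (x i ω)) v
  have h2 := h.trans hav
  have e1 : (n : ℝ) * (q ^ 2 / (2 * K ^ 4)) = lam * (n * q / 2) := by
    rw [hlam]
    field_simp
  have e2 : t + d * Real.log (2 / δ) =
      lam * (K ^ 4 / q * (t + d * Real.log (2 / δ))) := by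
    rw [hlam]
    field_simp
  have h3 : lam * (n * q / 2 - K ^ 4 / q * (t + d * Real.log (2 / δ))) ≤
      lam * (2 * S + n * (q / 8)) := by
    rw [mul_sub, ← e1, ← e2]
    linarith
  have h4 := le_of_mul_le_mul_left h3 hlam0
  rw [one_div, ← div_eq_inv_mul, le_div_iff₀ hn']
  have e3 : (3 * q / 16 - K ^ 4 / (2 * q) * (t / n + Real.log (2 / δ) * (d / n))) * n =
      3 * q / 16 * n - 1 / 2 * (K ^ 4 / q * (t + d * Real.log (2 / δ))) := by
    field_simp
  rw [e3]
  linarith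

/-- The role of the rate `τ₁ ∼ (n / log n)^{1/4}`: when `d log n / n` is small, the Markov bound
`d R / τ₁⁴` for the probability that shrinkage is active is at most `p`. -/
theorem mul_le_mul_threshold_pow_four {d n R c₁ p ε τ : ℝ} (hn : 2 ≤ n) (hR : 0 < R) (hc₁ : 0 < c₁)
    (hε : ε ^ 2 = c₁ ^ 4 * p / R) (hsmall : Real.sqrt (d * Real.log n / n) ≤ ε)
    (hτ : c₁ * (n / Real.log n) ^ ((1 : ℝ) / 4) ≤ τ) : d * R ≤ p * τ ^ 4 := by
  have hlog : 0 < Real.log n := Real.log_pos (by linarith)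
  have hn0 : 0 < n := by linarith
  have h1 : d * Real.log n / n ≤ ε ^ 2 :=
    (Real.sqrt_le_iff.1 hsmall).2
  have hp : 0 ≤ p := by
    have : 0 ≤ c₁ ^ 4 * p / R := hε ▸ sq_nonneg ε
    by_contra hp
    have : c₁ ^ 4 * p / R < 0 := div_neg_of_neg_of_pos (mul_neg_of_pos_of_neg (by positivity)
      (not_le.1 hp)) hR
    linarith
  have h2 : c₁ ^ 4 * (n / Real.log n) ≤ τ ^ 4 := by
    have hpos : 0 ≤ n / Real.log n := by positivity
    calc c₁ ^ 4 * (n / Real.log n) = (c₁ * (n / Real.log n) ^ ((1 : ℝ) / 4)) ^ 4 := by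
          rw [mul_pow, ← Real.rpow_natCast ((n / Real.log n) ^ ((1 : ℝ) / 4)),
            ← Real.rpow_mul hpos]
          norm_num
      _ ≤ τ ^ 4 := pow_le_pow_left₀ (by positivity) hτ 4
  rw [hε, div_le_div_iff₀ hn0 hR] at h1
  have h3 : d * R ≤ p * (c₁ ^ 4 * (n / Real.log n)) := by
    rw [← mul_div_assoc, ← mul_div_assoc, le_div_iff₀ hlog]
    linarith
  exact h3.trans (by gcongr)

theorem lemma1
    -- the constants of the assumptions
    (M κ₀ R L c₁ c₂ : ℝ) (m : ℝ → ℝ)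
    (hκ₀ : 0 < κ₀) (hc₁ : 0 < c₁) (hm : ∀ w : ℝ, 0 < w → 0 < m w) :
    ∃ κ C ε : ℝ, 0 < κ ∧ 0 < C ∧ 0 < ε ∧
      ∀ (d n : ℕ) (_hn : 2 ≤ n)
        (_hsmall : Real.sqrt (d * Real.log n / n) ≤ ε)
        (τ₁ τ₂ : ℝ)
        (_hτ₁ : c₁ * ((n : ℝ) / Real.log n) ^ ((1 : ℝ) / 4) ≤ τ₁ ∧
          τ₁ ≤ c₂ * ((n : ℝ) / Real.log n) ^ ((1 : ℝ) / 4))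
        (b : ℝ → ℝ) (_hb : Differentiable ℝ b) (_hb' : Differentiable ℝ (deriv b))
        (_hbm : ∀ w : ℝ, 0 < w → ∀ η : ℝ, |η| ≤ w → m w ≤ deriv (deriv b) η)
        (βs : EuclideanSpace ℝ (Fin d)) (_hβs : ‖βs‖ ≤ L)
        (Ω : Type*) [MeasurableSpace Ω] (μ : Measure Ω) [IsProbabilityMeasure μ]
        (x : Fin n → Ω → EuclideanSpace ℝ (Fin d)) (z : Fin n → Ω → ℝ)
        (_hxmeas : ∀ i, Measurable (x i))
        (_hxindep : iIndepFun x μ)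
        (_hbM : ∀ i, ∀ᵐ ω ∂μ, deriv (deriv b) (inner ℝ (x i ω) βs) ≤ M)
        (_hmean : ∀ i, ∫ ω, x i ω ∂μ = 0)
        (_hcov : ∀ i, κ₀ ≤ lambdaMin (secondMoment μ (x i)))
        (_hmom : ∀ i, ∀ v : EuclideanSpace ℝ (Fin d), ‖v‖ = 1 →
          Integrable (fun ω => (inner ℝ v (x i ω)) ^ 4) μ ∧
            ∫ ω, (inner ℝ v (x i ω)) ^ 4 ∂μ ≤ R)
        (r t : ℝ) (_hr₀ : 0 < r) (_hr₁ : r < 1) (_ht : 0 < t),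
        1 - 2 * Real.exp (-t) ≤
          μ.real {ω | ∀ Δ : EuclideanSpace ℝ (Fin d), ‖Δ‖ ≤ r →
            κ * ‖Δ‖ ^ 2 - C * r ^ 2 * (Real.sqrt (t / n) + Real.sqrt (d / n)) ≤
              taylorRemainder
                (shrunkNegLogLik b τ₁ τ₂ (fun i => x i ω) (fun i => z i ω))
                (βs + Δ) βs} := by
  set R₀ : ℝ := max R 1
  set L₀ : ℝ := |L| + 1
  have hR₀ : 1 ≤ R₀ := le_max_right _ _
  have hL₀ : 1 ≤ L₀ := by simp [L₀]
  have hR₀' : 0 < R₀ := by linarith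
  obtain ⟨η, hη⟩ : ∃ η, η = κ₀ / (256 * R₀) := ⟨_, rfl⟩
  obtain ⟨p, hp⟩ : ∃ p, p = η * κ₀ / 16 := ⟨_, rfl⟩
  have hη0 : 0 < η := by rw [hη]; positivity
  have hp0 : 0 < p := by rw [hp]; positivity
  -- `K` is so large that each truncation at level `K` has probability at most `p` of being active
  obtain ⟨K, hK1, hKp⟩ : ∃ K : ℝ, 1 ≤ K ∧ 16 * R₀ * L₀ ^ 4 ≤ p * K := by
    refine ⟨max 1 (16 * R₀ * L₀ ^ 4 / p), le_max_left _ _, ?_⟩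
    rw [← div_le_iff₀' hp0]
    exact le_max_right _ _
  have hK : 0 < K := by linarith
  have hKK2 : K ≤ K ^ 2 := le_self_pow₀ hK1 (by norm_num)
  have hKK4 : K ≤ K ^ 4 := le_self_pow₀ hK1 (by norm_num)
  have hL4 : 1 ≤ L₀ ^ 4 := one_le_pow₀ hL₀
  have hRL : R₀ ≤ R₀ * L₀ ^ 4 := le_mul_of_one_le_right hR₀'.le hL4
  have hpK2 : p * K ≤ p * K ^ 2 := by gcongr
  have hpK4 : p * K ≤ p * K ^ 4 := by gcongr
  obtain ⟨q, hq⟩ : ∃ q, q = κ₀ / 8 := ⟨_, rfl⟩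
  have hq0 : 0 < q := by rw [hq]; positivity
  obtain ⟨δ, hδ, hδ2, hδK⟩ : ∃ δ : ℝ, 0 < δ ∧ δ ≤ 1 / 2 ∧ δ ^ 2 * K ≤ q / 16 := by
    refine ⟨min (1 / 2) (q / (16 * K)), by positivity, min_le_left _ _, ?_⟩
    set δ := min (1 / 2) (q / (16 * K))
    have h0 : 0 < δ := by positivity
    have h1 : δ ≤ 1 / 2 := min_le_left _ _
    have h2 : δ * (16 * K) ≤ q := (le_div_iff₀ (by positivity)).1 (min_le_right _ _)
    nlinarith [mul_pos h0 hK]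
  have hlog : 0 ≤ Real.log (2 / δ) := Real.log_nonneg (by rw [le_div_iff₀ hδ]; linarith)
  set ℓ := Real.log (2 / δ)
  have hmK : 0 < m (3 * K) := hm _ (by positivity)
  obtain ⟨κ, hκ⟩ : ∃ κ, κ = m (3 * K) / 2 * (3 * q / 16) := ⟨_, rfl⟩
  have hκ0 : 0 < κ := by rw [hκ]; positivity
  obtain ⟨D, hD⟩ : ∃ D, D = m (3 * K) / 2 * (K ^ 4 / (2 * q)) * (1 + ℓ) := ⟨_, rfl⟩
  have hD0 : 0 ≤ D := by rw [hD]; positivity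
  refine ⟨κ, κ + D, c₁ ^ 2 * Real.sqrt (p / R₀), hκ0, by positivity, by positivity, ?_⟩
  intro d n hn hsmall τ₁ τ₂ hτ₁ b hb hb' hbm βs hβs Ω _ μ _ x z hxmeas hxindep _ _ hcov hmom r t
    hr₀ hr₁ ht
  have hn0 : 0 < n := by omega
  have hn' : (2 : ℝ) ≤ n := by exact_mod_cast hn
  have hnpos : (0 : ℝ) < n := by linarith
  -- in dimension zero the spectrum is empty and `lambdaMin` is `sInf ∅ = 0 < κ₀`
  have hd : 0 < d := by
    rcases Nat.eq_zero_or_pos d with rfl | h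
    · have h := hcov ⟨0, hn0⟩
      have hs : spectrum ℝ (secondMoment μ (x ⟨0, hn0⟩)) = ∅ :=
        spectrum.of_subsingleton _
      rw [lambdaMin, hs, Real.sInf_empty] at h
      linarith
    · exact h
  have hτ0 : 0 < τ₁ := by
    have : 0 < Real.log n := Real.log_pos (by linarith)
    exact lt_of_lt_of_le (by positivity) hτ₁.1
  have hε : (c₁ ^ 2 * Real.sqrt (p / R₀)) ^ 2 = c₁ ^ 4 * p / R₀ := by
    rw [mul_pow, Real.sq_sqrt (by positivity)]
    ring
  have hmean : ∀ i, ∀ θ : EuclideanSpace ℝ (Fin d), 1 / 2 ≤ ‖θ‖ → ‖θ‖ ≤ 2 →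
      q ≤ ∫ ω, localSq K K βs (shrink τ₁ (x i ω)) θ ∂μ := fun i θ h1 h2 => by
    rw [hq]
    refine le_integral_localSq_shrink hd hκ₀ hR₀' hK hτ0 hη hp (hxmeas i) (hcov i)
      (fun v hv => ⟨(hmom i v hv).1, (hmom i v hv).2.trans (le_max_left _ _)⟩)
      (L := L₀) (hβs.trans ?_) ?_ ?_ ?_ ?_ h1 h2
    · linarith [le_abs_self L]
    · exact mul_le_mul_threshold_pow_four hn' hR₀' hc₁ hε hsmall hτ₁.1
    · linarith
    · linarith
    · linarith
  have hprob := prob_forall_sum_localSq_ge hd hn0 hxmeas hxindep hK hq0 hδ hδ2 hδK hmean t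
  have hexp := Real.exp_pos (-t)
  refine le_trans (by linarith) (hprob.trans (measureReal_mono ?_ (measure_ne_top _ _)))
  intro ω hω Δ hΔ
  have hnonneg := taylorRemainder_negLogLik_nonneg hb hb' hm hbm
    (fun i => shrink τ₁ (x i ω)) (fun i => clip τ₂ (z i ω)) βs Δ
  have hs1 : 0 ≤ Real.sqrt (t / n) := Real.sqrt_nonneg _
  have hs2 : 0 ≤ Real.sqrt (d / n) := Real.sqrt_nonneg _
  set P := Real.sqrt (t / n) + Real.sqrt (d / n)
  have hΔ2 : ‖Δ‖ ^ 2 ≤ r ^ 2 := by gcongr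
  rw [shrunkNegLogLik]
  by_cases hP : 1 ≤ P
  · -- the claimed lower bound is nonpositive, while the remainder is nonnegative by convexity
    refine le_trans ?_ hnonneg
    have h1 : κ * ‖Δ‖ ^ 2 ≤ κ * r ^ 2 := by gcongr
    have h2 : (κ + D) * r ^ 2 * 1 ≤ (κ + D) * r ^ 2 * P := by gcongr
    have h3 := mul_nonneg hD0 (sq_nonneg r)
    linarith
  · have hle : ∀ s : ℝ, 0 ≤ s → Real.sqrt s < 1 → s ≤ Real.sqrt s := fun s hs h => by
      have h1 := mul_le_of_le_one_right (Real.sqrt_nonneg s) h.le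
      rwa [Real.mul_self_sqrt hs] at h1
    have ht' : t / n ≤ P := (hle _ (by positivity) (by linarith)).trans (by linarith)
    have hd' : (d : ℝ) / n ≤ P := (hle _ (by positivity) (by linarith)).trans (by linarith)
    have hP0 : 0 ≤ P := by positivity
    by_cases h0 : Δ = 0
    · refine le_trans ?_ hnonneg
      have : 0 ≤ (κ + D) * r ^ 2 * P := by positivity
      simp only [h0, norm_zero]
      linarith
    · have hΔ0 : ‖Δ‖ ≠ 0 := norm_ne_zero_iff.2 h0
      have hG := hω (‖Δ‖⁻¹ • Δ) (by rw [norm_smul, norm_inv, norm_norm, inv_mul_cancel₀ hΔ0])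
      have hT := mul_sum_localSq_le_taylorRemainder hb hb' hm hbm
        (fun i => shrink τ₁ (x i ω)) (fun i => clip τ₂ (z i ω)) βs (‖Δ‖⁻¹ • Δ) hK
        (norm_nonneg Δ) (hΔ.trans hr₁.le)
      rw [smul_inv_smul₀ hΔ0] at hT
      refine le_trans ?_ hT
      refine le_trans ?_ (mul_le_mul_of_nonneg_left hG (by positivity))
      have h1 : t / n + ℓ * (d / n) ≤ (1 + ℓ) * P := by
        have := mul_le_mul_of_nonneg_left hd' hlog
        linarith
      have h2 : m (3 * K) / 2 * (K ^ 4 / (2 * q)) * (t / n + ℓ * (d / n)) ≤ D * P := by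
        rw [hD, mul_assoc _ (1 + ℓ)]
        gcongr
      have h3 : ‖Δ‖ ^ 2 * (m (3 * K) / 2 * (K ^ 4 / (2 * q)) * (t / n + ℓ * (d / n))) ≤
          r ^ 2 * (D * P) := by
        refine (mul_le_mul_of_nonneg_left h2 (sq_nonneg _)).trans ?_
        exact mul_le_mul_of_nonneg_right hΔ2 (mul_nonneg hD0 hP0)
      have h4 : 0 ≤ κ * r ^ 2 * P := by positivity
      have h5 : m (3 * K) / 2 * ‖Δ‖ ^ 2 *
          (3 * q / 16 - K ^ 4 / (2 * q) * (t / n + ℓ * (d / n))) = κ * ‖Δ‖ ^ 2 -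
          ‖Δ‖ ^ 2 * (m (3 * K) / 2 * (K ^ 4 / (2 * q)) * (t / n + ℓ * (d / n))) := by
        rw [hκ]
        ring
      rw [h5]
      linarith
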